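/- A *system* is a pair $(A,\sigma)$ where $A$ is a commutative unital C*-algebra and $\sigma$ is a *-automorphism of $A$. Embeddings of systems are the injective unital *-homomorphisms that intertwine the automorphisms, and isomorphisms are the bijective ones; a *substructure* of $(A,\sigma)$ is a closed unital *-subalgebra $B$ with $\sigma(B)\subseteq B$. Let $\mathcal K$ be the class of systems $(A,\sigma)$ with $A$ nonzero and finite-dimensional. **Theorem 4.1.** (1) $\mathcal K$ is a Fraïssé class. That is, $\mathcal K$ is nonempty, its members are finitely generated, and: * (hereditary property) every finitely generated substructure of a member of $\mathcal K$ is the image of an embedding of a member of $\mathcal K$; * (joint embedding) any two members of $\mathcal K$ embed into a common member of $\mathcal K$; * (amalgamation) for all embeddings $\varphi_i:\mathcal A\to\mathcal B_i$ ($i=1,2$) between members of $\mathcal K$ there are $\mathcal C\in\mathcal K$ and embeddings $\psi_i:\mathcal B_i\to\mathcal C$ with $\psi_1\circ\varphi_1=\psi_2\circ\varphi_2$; * (separability) for every $n$, the $n$-tuples that generate a member of $\mathcal K$ form a separable space under $d(\bar a,\bar b)=\inf_{\varphi,\psi}\max_i\|\varphi(a_i)-\psi(b_i)\|$, where $\varphi,\psi$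 range over all embeddings of the two systems generated by $\bar a,\bar b$ into a common member of $\mathcal K$. (2) There is a homeomorphism $S$ of the Cantor set $2^{\mathbb N}$ such that, with $\sigma(f)=f\circ S$, the system $(C(2^{\mathbb N}),\sigma)$ is a Fraïssé limit of $\mathcal K$, and every Fraïssé limit of $\mathcal K$ is isomorphic to $(C(2^{\mathbb N}),\sigma)$. Here a *Fraïssé limit* of $\mathcal K$ is a separable system $\mathcal M$ such that * $\mathcal M$ is a direct limit of members of $\mathcal K$, i.e. the closure of the union of a nonempty upward directed family of substructures isomorphic to members of $\mathcal K$; * every member of $\mathcal K$ embeds into $\mathcal M$; * for every $\mathcal A\in\mathcal K$, all embeddings $\varphi,\psi:\mathcal A\to\mathcal M$, every finite tuple $\bar a$ in $\mathcal A$ and every $\varepsilon>0$ there is an automorphism $\alpha$ of $\mathcal M$ with $\|\alpha(\varphi(a_i))-\psi(a_i)\|<\varepsilon$ for all $i$. -/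

import Mathlib

universe u v

/-- A commutative unital C*-algebra together with an automorphism. -/
structure CStarSystem where
  carrier : Type u
  [inst : CommCStarAlgebra carrier]
  σ : carrier ≃⋆ₐ[ℂ] carrier

namespace CStarSystem

instance : CoeSort CStarSystem.{u} (Type u) := ⟨carrier⟩

instance (A : CStarSystem.{u}) : CommCStarAlgebra A := A.inst

/-- An embedding of systems: an injective (hence isometric) unital *-homomorphism that
intertwines the automorphisms. -/
structure Emb (A : CStarSystem.{u}) (B : CStarSystem.{v}) where
  toHom : A →⋆ₐ[ℂ] B
  injective : Function.Injective toHom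
  map_σ : ∀ a : A, toHom (A.σ a) = B.σ (toHom a)

instance (A : CStarSystem.{u}) (B : CStarSystem.{v}) : CoeFun (Emb A B) (fun _ => A → B) :=
  ⟨fun φ => φ.toHom⟩

/-- An isomorphism of systems: a *-isomorphism that intertwines the automorphisms. -/
structure Iso (A : CStarSystem.{u}) (B : CStarSystem.{v}) where
  toEquiv : A ≃⋆ₐ[ℂ] B
  map_σ : ∀ a : A, toEquiv (A.σ a) = B.σ (toEquiv a)

instance (A : CStarSystem.{u}) (B : CStarSystem.{v}) : CoeFun (Iso A B) (fun _ => A → B) :=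
  ⟨fun φ => φ.toEquiv⟩

/-- The substructure generated by `s`: the smallest closed unital *-subalgebra that contains `s`
and is mapped into itself by the automorphism. -/
noncomputable def generated (A : CStarSystem.{u}) (s : Set A) : StarSubalgebra ℂ A :=
  sInf {B : StarSubalgebra ℂ A | IsClosed (B : Set A) ∧ (∀ x ∈ B, A.σ x ∈ B) ∧ s ⊆ (B : Set A)}

/-- The system `(C(X), f ↦ f ∘ S)` of a homeomorphism `S` of a compact space `X`. -/
noncomputable def ofHomeo {X : Type u} [TopologicalSpace X] [CompactSpace X] (S : X ≃ₜ X) :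
    CStarSystem.{u} where
  carrier := C(X, ℂ)
  σ := S.compStarAlgEquiv' ℂ ℂ

end CStarSystem

open CStarSystem

section FraisseTheory

variable (K : CStarSystem.{u} → Prop)

/-- A finite-length tuple in a system. -/
structure PointedSystem (n : ℕ) where
  sys : CStarSystem.{u}
  pt : Fin n → sys

/-- The `n`-tuples that generate a member of `K`. -/
def generatingTuples (n : ℕ) : Set (PointedSystem.{u} n) :=
  {x | K x.sys ∧ x.sys.generated (Set.range x.pt) = ⊤}

/-- The distance of two tuples: the infimum of the distances of their images
over all pairs of embeddings into a common member of `K`. -/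
noncomputable def jointEDist {n : ℕ} (x y : PointedSystem.{u} n) : ENNReal :=
  ⨅ (C : CStarSystem.{u}) (_ : K C) (φ : Emb x.sys C) (ψ : Emb y.sys C),
    ⨆ i, edist (φ (x.pt i)) (ψ (y.pt i))

/-- Finitely generated substructures of members of `K` are (isomorphic to) members of `K`. -/
def HereditaryProperty : Prop :=
  ∀ A, K A → ∀ (n : ℕ) (a : Fin n → A), ∃ B, K B ∧ ∃ φ : Emb B A,
    Set.range φ = (A.generated (Set.range a) : Set A)

/-- Any two members of `K` embed into a common member of `K`. -/
def JointEmbeddingProperty : Prop :=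
  ∀ A B, K A → K B → ∃ C, K C ∧ Nonempty (Emb A C) ∧ Nonempty (Emb B C)

/-- Any two embeddings out of a member of `K` can be (exactly) amalgamated in `K`. -/
def AmalgamationProperty : Prop :=
  ∀ A B₁ B₂, K A → K B₁ → K B₂ → ∀ (φ₁ : Emb A B₁) (φ₂ : Emb A B₂),
    ∃ C, K C ∧ ∃ (ψ₁ : Emb B₁ C) (ψ₂ : Emb B₂ C), ∀ a : A, ψ₁ (φ₁ a) = ψ₂ (φ₂ a)

/-- For every `n` the space of generating `n`-tuples of members of `K` is separable. -/
def WeakPolishProperty : Prop :=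
  ∀ n : ℕ, ∃ D : Set (PointedSystem.{u} n), D.Countable ∧ D ⊆ generatingTuples K n ∧
    ∀ x ∈ generatingTuples K n, ∀ ε : ENNReal, 0 < ε → ∃ y ∈ D, jointEDist K x y < ε

/-- Fraïssé classes in the sense of continuous logic. -/
structure IsFraisseClass : Prop where
  nonempty : ∃ A, K A
  finitelyGenerated : ∀ A, K A → ∃ (n : ℕ) (a : Fin n → A), A.generated (Set.range a) = ⊤
  hereditary : HereditaryProperty K
  jointEmbedding : JointEmbeddingProperty K
  amalgamation : AmalgamationProperty K
  weakPolish : WeakPolishProperty K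

/-- `M` is a direct limit of members of `K`: it is the closure of the union of a (nonempty)
upward directed family of substructures that are isomorphic to members of `K`. -/
def IsDirectLimitOf (M : CStarSystem.{v}) : Prop :=
  ∃ F : Set (StarSubalgebra ℂ M), F.Nonempty ∧ DirectedOn (· ≤ ·) F ∧
    (∀ B ∈ F, ∃ A, K A ∧ ∃ φ : Emb A M, Set.range φ = (B : Set M)) ∧
    Dense (⋃ B ∈ F, (B : Set M))

/-- Fraïssé limits in the sense of continuous logic: separable direct limits of members of `K`
that are universal and approximately homogeneous for `K`. -/
structure IsFraisseLimit (M : CStarSystem.{v}) : Prop where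
  separable : TopologicalSpace.SeparableSpace M
  directLimit : IsDirectLimitOf K M
  universal : ∀ A, K A → Nonempty (Emb A M)
  homogeneous : ∀ A, K A → ∀ (φ ψ : Emb A M) (n : ℕ) (a : Fin n → A) (ε : ℝ), 0 < ε →
    ∃ α : Iso M M, ∀ i, ‖α (φ (a i)) - ψ (a i)‖ < ε

end FraisseTheory

/-- The class of (nonzero) finite-dimensional commutative C*-algebras with an automorphism. -/
def FinDimClass (A : CStarSystem.{u}) : Prop :=
  Nontrivial A ∧ FiniteDimensional ℂ A

/-!
Under Gelfand duality a finite-dimensional system is a permutation of a nonempty finite set, and an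
embedding is an equivariant surjection in the opposite direction. Joint embeddings and amalgams are
therefore dual to products and fibre products of finite permutations.

Two idempotents of a commutative Banach algebra at distance less than one are equal, and a
finite-dimensional commutative C*-algebra is spanned by idempotents. Hence approximate homogeneity
is exact homogeneity, every Fraïssé limit extends embeddings of finite-dimensional systems, and a
back-and-forth argument shows that the limit is unique.

For existence, let `S` rotate all the cycles in the Cantor set `∏ n, (ℤ/(n+1)) × 2^ℕ`. An
equivariant map onto a finite permutation depends on finitely many coordinates only. To lift it
along an equivariant surjection of finite permutations, use an unused coordinate whose cycle length
is a multiple of the order of the permutation upstairs: the cycle keeps track of time, and the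
factor `2^ℕ` picks a point of the fibre. This is the extension property of `C(2^ℕ)`.
-/

universe w

open Function Set WeakDual

/-! ### Commutative C*-algebras and finite spectra -/

theorem eq_of_isIdempotentElem_of_norm_sub_lt_one {R : Type*} [NormedCommRing R] {p q : R}
    (hp : IsIdempotentElem p) (hq : IsIdempotentElem q) (h : ‖p - q‖ < 1) : p = q := by
  have hcube : (p - q) * ((p - q) * (p - q)) = p - q := by
    linear_combination (p - 3 * q + 1) * hp.eq + (3 * p - q - 1) * hq.eq
  by_contra hne
  have hpos : 0 < ‖p - q‖ := norm_pos_iff.2 (sub_ne_zero.2 hne)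
  have hle : ‖p - q‖ ≤ ‖p - q‖ * (‖p - q‖ * ‖p - q‖) :=
    calc ‖p - q‖ = ‖(p - q) * ((p - q) * (p - q))‖ := by rw [hcube]
      _ ≤ ‖p - q‖ * ‖(p - q) * (p - q)‖ := norm_mul_le _ _
      _ ≤ ‖p - q‖ * (‖p - q‖ * ‖p - q‖) := by gcongr; exact norm_mul_le _ _
  nlinarith

theorem surjective_of_injective_comp {X Y : Type*} [TopologicalSpace X] [CompactSpace X]
    [TopologicalSpace Y] [CompactSpace Y] [T2Space Y] (f : C(X, Y))
    (hf : Injective fun g : C(Y, ℂ) => g.comp f) : Surjective f := by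
  have hopen : IsOpen (range f)ᶜ := (isCompact_range f.continuous).isClosed.isOpen_compl
  have hbot : ContinuousMap.idealOfSet ℂ (range f)ᶜ = ⊥ := by
    refine (Submodule.eq_bot_iff _).2 fun g hg => hf (ContinuousMap.ext fun x => ?_)
    exact ContinuousMap.mem_idealOfSet.1 hg (by simp)
  have hempty : (range f)ᶜ = ∅ := by
    rw [← ContinuousMap.setOfIdeal_ofSet_of_isOpen ℂ hopen, hbot]
    exact (ContinuousMap.ideal_gc Y ℂ).l_bot
  exact range_eq_univ.1 (compl_empty_iff.1 hempty)

theorem eq_of_forall_character_apply_eq {A : Type*} [CommCStarAlgebra A] {a b : A}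
    (h : ∀ x : characterSpace ℂ A, x a = x b) : a = b :=
  EquivLike.injective (gelfandStarTransform A) (ContinuousMap.ext h)

instance finite_characterSpace (A : Type*) [CommCStarAlgebra A] [FiniteDimensional ℂ A] :
    Finite (characterSpace ℂ A) :=
  Finite.of_injective (fun x => CharacterSpace.toAlgHom x : characterSpace ℂ A → (A →ₐ[ℂ] ℂ))
    fun _ _ h => CharacterSpace.ext fun a => DFunLike.congr_fun h a

instance finiteDimensional_continuousMap (X 𝕜 : Type*) [TopologicalSpace X] [Finite X]
    [NormedField 𝕜] : FiniteDimensional 𝕜 C(X, 𝕜) :=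
  FiniteDimensional.of_injective (ContinuousMap.coeFnLinearMap 𝕜 : C(X, 𝕜) →ₗ[𝕜] (X → 𝕜))
    DFunLike.coe_injective

theorem exists_basis_isIdempotentElem (A : Type*) [CommCStarAlgebra A] [FiniteDimensional ℂ A] :
    ∃ (n : ℕ) (b : Module.Basis (Fin n) ℂ A), ∀ i, IsIdempotentElem (b i) := by
  classical
  let X := characterSpace ℂ A
  let coeFn : C(X, ℂ) ≃ₐ[ℂ] (X → ℂ) := AlgEquiv.ofBijective (ContinuousMap.coeFnAlgHom ℂ)
    (ContinuousMap.equivFnOfDiscrete (α := X) (β := ℂ)).bijective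
  let gelfand : A ≃ₐ[ℂ] (X → ℂ) := (gelfandStarTransform A).toAlgEquiv.trans coeFn
  obtain ⟨n, ⟨e⟩⟩ := Finite.exists_equiv_fin X
  have := Fintype.ofFinite X
  refine ⟨n, ((Pi.basisFun ℂ X).map gelfand.symm.toLinearEquiv).reindex e, fun i => ?_⟩
  have hsingle : IsIdempotentElem (Pi.single (e.symm i) 1 : X → ℂ) := by
    rw [IsIdempotentElem, ← Pi.single_mul, one_mul]
  simpa using hsingle.map gelfand.symm

theorem finiteDimensional_sup {𝕜 A : Type*} [Field 𝕜] [StarRing 𝕜] [CommRing A] [StarRing A]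
    [Algebra 𝕜 A] [StarModule 𝕜 A] (B C : StarSubalgebra 𝕜 A) [hB : FiniteDimensional 𝕜 B]
    [hC : FiniteDimensional 𝕜 C] : FiniteDimensional 𝕜 (B ⊔ C : StarSubalgebra 𝕜 A) := by
  have hstar : B.toSubalgebra ⊔ C.toSubalgebra ≤ star (B.toSubalgebra ⊔ C.toSubalgebra) :=
    sup_le (fun _ hx => le_sup_left (a := B.toSubalgebra) (star_mem (s := B) hx))
      fun _ hx => le_sup_right (b := C.toSubalgebra) (star_mem (s := C) hx)
  let T : StarSubalgebra 𝕜 A := ⟨B.toSubalgebra ⊔ C.toSubalgebra, fun hx => hstar hx⟩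
  have hle : B ⊔ C ≤ T := sup_le (fun _ hx => le_sup_left (a := B.toSubalgebra) hx)
    fun _ hx => le_sup_right (b := C.toSubalgebra) hx
  have : FiniteDimensional 𝕜 B.toSubalgebra := hB
  have : FiniteDimensional 𝕜 C.toSubalgebra := hC
  have : FiniteDimensional 𝕜 (Subalgebra.toSubmodule T.toSubalgebra) :=
    Subalgebra.finite_sup B.toSubalgebra C.toSubalgebra
  exact Submodule.finiteDimensional_of_le
    (S₁ := Subalgebra.toSubmodule (B ⊔ C).toSubalgebra)
    (S₂ := Subalgebra.toSubmodule T.toSubalgebra) hle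

theorem bijective_of_injective_of_denseRange {A B : Type*} [CStarAlgebra A] [CStarAlgebra B]
    (g : A →⋆ₐ[ℂ] B) (hg : Injective g) (hdense : DenseRange g) : Bijective g := by
  have hclosed : IsClosed (range g) :=
    (NonUnitalStarAlgHom.isometry g hg).isClosedEmbedding.isClosed_range
  exact ⟨hg, range_eq_univ.1 (hclosed.closure_eq ▸ hdense.closure_range)⟩

theorem exists_starAlgEquiv_of_isClosed_graph {A B : Type*} [CStarAlgebra A] [CStarAlgebra B]
    (Γ : StarSubalgebra ℂ (A × B)) [IsClosed (Γ : Set (A × B))]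
    (hzero : ∀ p ∈ Γ, p.1 = 0 ↔ p.2 = 0) (hfst : Dense (Prod.fst '' (Γ : Set (A × B))))
    (hsnd : Dense (Prod.snd '' (Γ : Set (A × B)))) :
    ∃ e : A ≃⋆ₐ[ℂ] B, ∀ p ∈ Γ, e p.1 = p.2 := by
  let g₁ : Γ →⋆ₐ[ℂ] A := (StarAlgHom.fst ℂ A B).comp Γ.subtype
  let g₂ : Γ →⋆ₐ[ℂ] B := (StarAlgHom.snd ℂ A B).comp Γ.subtype
  have hg₁ : Bijective g₁ := by
    refine bijective_of_injective_of_denseRange g₁ ?_ (hfst.mono ?_)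
    · exact (injective_iff_map_eq_zero _).2 fun p hp =>
        Subtype.ext (Prod.ext hp ((hzero p p.2).1 hp))
    · rintro _ ⟨p, hp, rfl⟩
      exact ⟨⟨p, hp⟩, rfl⟩
  have hg₂ : Bijective g₂ := by
    refine bijective_of_injective_of_denseRange g₂ ?_ (hsnd.mono ?_)
    · exact (injective_iff_map_eq_zero _).2 fun p hp =>
        Subtype.ext (Prod.ext ((hzero p p.2).2 hp) hp)
    · rintro _ ⟨p, hp, rfl⟩
      exact ⟨⟨p, hp⟩, rfl⟩
  let e₁ := StarAlgEquiv.ofBijective g₁ hg₁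
  let e₂ := StarAlgEquiv.ofBijective g₂ hg₂
  exact ⟨e₁.symm.trans e₂, fun p hp => congrArg e₂ (e₁.symm_apply_apply (⟨p, hp⟩ : Γ))⟩

/-! ### Embeddings and isomorphisms -/

namespace CStarSystem

variable {A : CStarSystem.{u}} {B : CStarSystem.{v}} {M : CStarSystem.{w}}

/-- The composition of two embeddings. -/
noncomputable def Emb.comp (ψ : Emb B M) (φ : Emb A B) : Emb A M where
  toHom := ψ.toHom.comp φ.toHom
  injective := ψ.injective.comp φ.injective
  map_σ a := (congrArg ψ (φ.map_σ a)).trans (ψ.map_σ (φ a))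

theorem Emb.norm_map (φ : Emb A B) (a : A) : ‖φ a‖ = ‖a‖ :=
  NonUnitalStarAlgHom.norm_map φ.toHom φ.injective a

/-- An isomorphism regarded as an embedding. -/
noncomputable def Iso.toEmb (e : Iso A B) : Emb A B where
  toHom := e.toEquiv.toStarAlgHom
  injective := e.toEquiv.injective
  map_σ := e.map_σ

/-- The identity isomorphism. -/
noncomputable def Iso.refl (A : CStarSystem.{u}) : Iso A A where
  toEquiv := StarAlgEquiv.refl ℂ A
  map_σ _ := rfl

/-- The inverse isomorphism. -/
noncomputable def Iso.symm (e : Iso A B) : Iso B A where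
  toEquiv := e.toEquiv.symm
  map_σ b := by
    apply EquivLike.injective e.toEquiv
    rw [e.map_σ, StarAlgEquiv.apply_symm_apply, StarAlgEquiv.apply_symm_apply]

theorem Iso.apply_symm_apply (e : Iso A B) (b : B) : e (e.symm b) = b :=
  e.toEquiv.apply_symm_apply b

theorem Iso.symm_apply_apply (e : Iso A B) (a : A) : e.symm (e a) = a :=
  e.toEquiv.symm_apply_apply a

theorem continuous_σ (A : CStarSystem.{u}) : Continuous A.σ :=
  (NonUnitalStarAlgHom.isometry A.σ (EquivLike.injective _)).continuous

theorem Emb.exists_factor (φ : Emb A M) (χ : Emb B M) (h : range φ ⊆ range χ) :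
    ∃ ι : Emb A B, ∀ a, χ (ι a) = φ a := by
  have hmem : ∀ a, φ.toHom a ∈ χ.toHom.range := fun a => h ⟨a, rfl⟩
  let e := StarAlgEquiv.ofInjective χ.toHom χ.injective
  let g : A →⋆ₐ[ℂ] B := e.symm.toStarAlgHom.comp (φ.toHom.codRestrict _ hmem)
  have hg : ∀ a, χ (g a) = φ a := fun a => congrArg Subtype.val <|
    show e (g a) = φ.toHom.codRestrict _ hmem a from e.apply_symm_apply _
  refine ⟨⟨g, fun a b hab => φ.injective ?_, fun a => χ.injective ?_⟩, hg⟩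
  · rw [← hg a, ← hg b, hab]
  · rw [hg, φ.map_σ, χ.map_σ, hg]

theorem subset_generated (A : CStarSystem.{u}) (s : Set A) : s ⊆ (A.generated s : Set A) :=
  fun _ hx => StarSubalgebra.mem_sInf.2 fun _ hB => hB.2.2 hx

theorem map_mem_generated (A : CStarSystem.{u}) (s : Set A) {x : A} (hx : x ∈ A.generated s) :
    A.σ x ∈ A.generated s :=
  StarSubalgebra.mem_sInf.2 fun B hB => hB.2.1 _ (StarSubalgebra.mem_sInf.1 hx B hB)

theorem generated_range_basis {ι : Type*} (b : Module.Basis ι ℂ A) :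
    A.generated (range b) = ⊤ := by
  refine StarSubalgebra.eq_top_iff.2 fun x => ?_
  have h : Submodule.span ℂ (range b) ≤
      Subalgebra.toSubmodule (A.generated (range b)).toSubalgebra :=
    Submodule.span_le.2 (A.subset_generated _)
  exact h (b.mem_span x)

theorem Iso.generated_image_eq_top (e : Iso A B) {s : Set A} (hs : A.generated s = ⊤) :
    B.generated (e '' s) = ⊤ := by
  refine StarSubalgebra.eq_top_iff.2 fun b => StarSubalgebra.mem_sInf.2 fun T hT => ?_
  obtain ⟨hclosed, hσ, hsub⟩ := hT
  have he : Continuous e := (NonUnitalStarAlgHom.isometry e.toEquiv e.toEquiv.injective).continuous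
  have h : A.generated s ≤ T.comap e.toEquiv.toStarAlgHom := by
    refine sInf_le ⟨hclosed.preimage he, fun x hx => ?_, fun x hx => hsub ⟨x, hx, rfl⟩⟩
    change e (A.σ x) ∈ T
    rw [e.map_σ]
    exact hσ _ hx
  have hb : e (e.symm b) ∈ T := h (hs ▸ StarSubalgebra.mem_top)
  rwa [e.apply_symm_apply] at hb

/-! ### Gelfand duality for systems -/

/-- The homeomorphism of the character space that is dual to the automorphism of a system. -/
noncomputable def specHomeo (A : CStarSystem.{u}) : characterSpace ℂ A ≃ₜ characterSpace ℂ A where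
  toFun := CharacterSpace.compContinuousMap A.σ.toStarAlgHom
  invFun := CharacterSpace.compContinuousMap A.σ.symm.toStarAlgHom
  left_inv x := CharacterSpace.ext fun a => congrArg x (A.σ.apply_symm_apply a)
  right_inv x := CharacterSpace.ext fun a => congrArg x (A.σ.symm_apply_apply a)
  continuous_toFun := ContinuousMap.continuous _
  continuous_invFun := ContinuousMap.continuous _

/-- The map of character spaces that is dual to an embedding. -/
noncomputable def Emb.dual (φ : Emb A B) : C(characterSpace ℂ B, characterSpace ℂ A) :=
  CharacterSpace.compContinuousMap φ.toHom

theorem Emb.dual_semiconj (φ : Emb A B) : Semiconj φ.dual B.specHomeo A.specHomeo :=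
  fun x => CharacterSpace.ext fun a => congrArg x (φ.map_σ a).symm

theorem Emb.dual_surjective (φ : Emb A B) : Surjective φ.dual := by
  refine surjective_of_injective_comp _ fun g₁ g₂ h => ?_
  obtain ⟨a, rfl⟩ := (gelfandStarTransform A).surjective g₁
  obtain ⟨b, rfl⟩ := (gelfandStarTransform A).surjective g₂
  have hab : φ a = φ b := eq_of_forall_character_apply_eq fun x => DFunLike.congr_fun h x
  rw [φ.injective hab]

section OfHomeo

variable {X : Type v} [TopologicalSpace X] [CompactSpace X] {S : X ≃ₜ X}

/-- The map from `X` to the character space of `A` that is dual to an embedding of `A` into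
`C(X)`. -/
noncomputable def Emb.evalDual (φ : Emb A (ofHomeo S)) : C(X, characterSpace ℂ A) :=
  (CharacterSpace.compContinuousMap (B := C(X, ℂ)) φ.toHom).comp
    (CharacterSpace.continuousMapEval X ℂ)

theorem Emb.evalDual_semiconj (φ : Emb A (ofHomeo S)) : Semiconj φ.evalDual S A.specHomeo :=
  fun x => CharacterSpace.ext fun a =>
    (DFunLike.congr_fun (F := C(X, ℂ)) (φ.map_σ a) x).symm

theorem Emb.evalDual_surjective [T2Space X] (φ : Emb A (ofHomeo S)) : Surjective φ.evalDual :=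
  φ.dual_surjective.comp (CharacterSpace.continuousMapEval_bijective (X := X) (𝕜 := ℂ)).2

/-- The embedding of `A` into `C(X)` that is dual to an equivariant continuous surjection from `X`
onto the character space of `A`. -/
noncomputable def Emb.ofSurjective (f : C(X, characterSpace ℂ A)) (hf : Surjective f)
    (hfS : Semiconj f S A.specHomeo) : Emb A (ofHomeo S) where
  toHom := (ContinuousMap.compStarAlgHom' ℂ ℂ f).comp (gelfandStarTransform A).toStarAlgHom
  injective _ _ hab := eq_of_forall_character_apply_eq <| hf.forall.2 fun x =>
    DFunLike.congr_fun (F := C(X, ℂ)) hab x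
  map_σ a := ContinuousMap.ext fun x => (DFunLike.congr_fun (hfS x) a).symm

/-- The isomorphism of `A` with `C(X)` that is dual to an equivariant homeomorphism from `X` onto
the character space of `A`. -/
noncomputable def Iso.ofHomeomorph (f : X ≃ₜ characterSpace ℂ A)
    (hfS : Semiconj f S A.specHomeo) : Iso A (ofHomeo S) where
  toEquiv := (gelfandStarTransform A).trans (f.compStarAlgEquiv' ℂ ℂ)
  map_σ a := ContinuousMap.ext fun x => (DFunLike.congr_fun (hfS x) a).symm

end OfHomeo

/-! ### Finite-dimensional systems -/

theorem finDimClass_ofHomeo {X : Type u} [TopologicalSpace X] [CompactSpace X] [Finite X]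
    [Nonempty X] (S : X ≃ₜ X) : FinDimClass (ofHomeo S) :=
  ⟨inferInstanceAs (Nontrivial C(X, ℂ)), finiteDimensional_continuousMap X ℂ⟩

/-- The system of a permutation of a finite set, in an arbitrary universe. -/
noncomputable def ofPerm (n : ℕ) (π : Equiv.Perm (Fin n)) : CStarSystem.{u} :=
  ofHomeo (X := ULift.{u} (Fin n))
    (Homeomorph.ulift.trans (π.toHomeomorphOfDiscrete.trans Homeomorph.ulift.symm))

theorem exists_iso_ofPerm (hA : FinDimClass A) :
    ∃ (n : ℕ) (π : Equiv.Perm (Fin n)),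
      FinDimClass (ofPerm.{v} n π) ∧ Nonempty (Iso A (ofPerm.{v} n π)) := by
  obtain ⟨_, _⟩ := hA
  obtain ⟨n, ⟨e⟩⟩ := Finite.exists_equiv_fin (characterSpace ℂ A)
  have : Nonempty (ULift.{v} (Fin n)) := ⟨⟨e (Classical.arbitrary _)⟩⟩
  refine ⟨n, (e.symm.trans A.specHomeo.toEquiv).trans e, finDimClass_ofHomeo _,
    ⟨Iso.ofHomeomorph (Homeomorph.ulift.trans e.symm.toHomeomorphOfDiscrete) fun x => ?_⟩⟩
  exact e.symm_apply_apply _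

/-- A finite-dimensional star subalgebra that is mapped into itself by the automorphism. -/
structure IsFinInvariant (B : StarSubalgebra ℂ M) : Prop where
  finite : FiniteDimensional ℂ B
  map_mem : ∀ x ∈ B, M.σ x ∈ B

theorem IsFinInvariant.exists_emb [Nontrivial M] {B : StarSubalgebra ℂ M}
    (hB : IsFinInvariant B) :
    ∃ A : CStarSystem.{u}, FinDimClass A ∧ ∃ φ : Emb A M, range φ = (B : Set M) := by
  have hfin := hB.finite
  have hclosed : IsClosed (B : Set M) :=
    Submodule.closed_of_finiteDimensional (Subalgebra.toSubmodule B.toSubalgebra)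
  let g : B →⋆ₐ[ℂ] B :=
    (M.σ.toStarAlgHom.comp B.subtype).codRestrict B fun x => hB.map_mem _ x.2
  have hinj : Injective g := fun x y h => Subtype.ext (M.σ.injective (congrArg Subtype.val h))
  have hsurj : Surjective g := LinearMap.surjective_of_injective (f := g.toAlgHom.toLinearMap) hinj
  let D : CStarSystem.{w} := ⟨B, StarAlgEquiv.ofBijective g ⟨hinj, hsurj⟩⟩
  let incl : Emb D M := ⟨B.subtype, Subtype.val_injective, fun _ => rfl⟩
  obtain ⟨n, π, hA, ⟨e⟩⟩ := exists_iso_ofPerm.{w, u} (A := D) ⟨inferInstanceAs (Nontrivial B), hfin⟩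
  refine ⟨_, hA, incl.comp e.symm.toEmb, Subset.antisymm ?_ fun x hx => ?_⟩
  · rintro _ ⟨a, rfl⟩
    exact (e.symm a).2
  · exact ⟨e (⟨x, hx⟩ : B), congrArg incl (e.symm_apply_apply _)⟩

theorem isFinInvariant_range {A : Type*} [CommCStarAlgebra A] [FiniteDimensional ℂ A]
    (g : A →⋆ₐ[ℂ] M) (hg : ∀ a, M.σ (g a) ∈ g.range) : IsFinInvariant g.range where
  finite := inferInstanceAs (FiniteDimensional ℂ (LinearMap.range g.toAlgHom.toLinearMap))
  map_mem := by
    rintro _ ⟨a, rfl⟩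
    exact hg a

theorem Emb.isFinInvariant_range [FiniteDimensional ℂ A] (φ : Emb A M) :
    IsFinInvariant φ.toHom.range :=
  CStarSystem.isFinInvariant_range φ.toHom fun a => ⟨A.σ a, φ.map_σ a⟩

theorem isFinInvariant_bot : IsFinInvariant (⊥ : StarSubalgebra ℂ M) where
  finite := inferInstanceAs (FiniteDimensional ℂ (⊥ : Subalgebra ℂ M))
  map_mem := (bot_le : ⊥ ≤ (⊥ : StarSubalgebra ℂ M).comap M.σ.toStarAlgHom)

theorem IsFinInvariant.sup {B C : StarSubalgebra ℂ M} (hB : IsFinInvariant B)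
    (hC : IsFinInvariant C) : IsFinInvariant (B ⊔ C) where
  finite :=
    have := hB.finite
    have := hC.finite
    finiteDimensional_sup B C
  map_mem :=
    have hle : B ⊔ C ≤ (B ⊔ C).comap M.σ.toStarAlgHom :=
      sup_le (fun x hx => StarSubalgebra.mem_sup_left (hB.map_mem x hx))
        fun x hx => StarSubalgebra.mem_sup_right (hC.map_mem x hx)
    hle

/-! ### The Fraïssé class -/

theorem exists_joint_embedding {B₁ B₂ : CStarSystem.{u}} (h₁ : FinDimClass B₁)
    (h₂ : FinDimClass B₂) (P : characterSpace ℂ B₁ → characterSpace ℂ B₂ → Prop)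
    (hP : ∀ x y, P x y ↔ P (B₁.specHomeo x) (B₂.specHomeo y))
    (hl : ∀ x, ∃ y, P x y) (hr : ∀ y, ∃ x, P x y) :
    ∃ C : CStarSystem.{u}, FinDimClass C ∧ ∃ (ψ₁ : Emb B₁ C) (ψ₂ : Emb B₂ C), ∀ b₁ b₂,
      (∀ x y, P x y → x b₁ = y b₂) → ψ₁ b₁ = ψ₂ b₂ := by
  obtain ⟨_, _⟩ := h₁
  obtain ⟨_, _⟩ := h₂
  let X := {p : characterSpace ℂ B₁ × characterSpace ℂ B₂ // P p.1 p.2}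
  let S : X ≃ₜ X := Equiv.toHomeomorphOfDiscrete <|
    (B₁.specHomeo.toEquiv.prodCongr B₂.specHomeo.toEquiv).subtypeEquiv fun p => hP p.1 p.2
  have hfst : Surjective fun p : X => p.1.1 := fun x =>
    let ⟨y, hy⟩ := hl x
    ⟨⟨(x, y), hy⟩, rfl⟩
  have hsnd : Surjective fun p : X => p.1.2 := fun y =>
    let ⟨x, hx⟩ := hr y
    ⟨⟨(x, y), hx⟩, rfl⟩
  have : Nonempty X := hfst.nonempty
  let ψ₁ : Emb B₁ (ofHomeo S) :=
    .ofSurjective ⟨fun p => p.1.1, continuous_of_discreteTopology⟩ hfst fun _ => rfl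
  let ψ₂ : Emb B₂ (ofHomeo S) :=
    .ofSurjective ⟨fun p => p.1.2, continuous_of_discreteTopology⟩ hsnd fun _ => rfl
  exact ⟨ofHomeo S, finDimClass_ofHomeo S, ψ₁, ψ₂, fun b₁ b₂ h =>
    ContinuousMap.ext (X := X) (Y := ℂ) fun p => h _ _ p.2⟩

theorem jointEmbeddingProperty_finDimClass : JointEmbeddingProperty FinDimClass.{u} := by
  intro A B hA hB
  have := hA.1
  have := hB.1
  obtain ⟨C, hC, ψ₁, ψ₂, -⟩ := exists_joint_embedding hA hB (fun _ _ => True)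
    (fun _ _ => Iff.rfl) (fun _ => ⟨Classical.arbitrary _, trivial⟩)
    (fun _ => ⟨Classical.arbitrary _, trivial⟩)
  exact ⟨C, hC, ⟨ψ₁⟩, ⟨ψ₂⟩⟩

theorem amalgamationProperty_finDimClass : AmalgamationProperty FinDimClass.{u} := by
  intro A B₁ B₂ _ h₁ h₂ φ₁ φ₂
  obtain ⟨C, hC, ψ₁, ψ₂, h⟩ := exists_joint_embedding h₁ h₂ (fun x y => φ₁.dual x = φ₂.dual y)
    (fun x y => by rw [φ₁.dual_semiconj, φ₂.dual_semiconj, A.specHomeo.injective.eq_iff])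
    (fun x => (φ₂.dual_surjective (φ₁.dual x)).imp fun _ => Eq.symm)
    (fun y => φ₁.dual_surjective (φ₂.dual y))
  exact ⟨C, hC, ψ₁, ψ₂, fun a => h _ _ fun x y hxy => DFunLike.congr_fun hxy a⟩

theorem hereditaryProperty_finDimClass : HereditaryProperty FinDimClass.{u} := by
  rintro A ⟨_, _⟩ n a
  exact IsFinInvariant.exists_emb
    ⟨FiniteDimensional.finiteDimensional_submodule
      (Subalgebra.toSubmodule (A.generated (range a)).toSubalgebra),
      fun x hx => A.map_mem_generated _ hx⟩

theorem jointEDist_map_le {K : CStarSystem.{u} → Prop} {A B : CStarSystem.{u}} (hB : K B)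
    (φ : Emb A B) {n : ℕ} (a : Fin n → A) (b : Fin n → B) :
    jointEDist K ⟨A, a⟩ ⟨B, b⟩ ≤ edist (fun i => φ (a i)) b :=
  iInf_le_of_le B <| iInf_le_of_le hB <| iInf_le_of_le φ <| iInf_le_of_le (Iso.refl B).toEmb <|
    iSup_le fun i => edist_le_pi_edist (fun i => φ (a i)) b i

theorem weakPolishProperty_finDimClass : WeakPolishProperty FinDimClass.{u} := by
  intro n
  let T (m : ℕ) (π : Equiv.Perm (Fin m)) : Set (Fin n → ofPerm.{u} m π) :=
    {a | ⟨_, a⟩ ∈ generatingTuples FinDimClass n}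
  have hdense : ∀ m π, ∃ D ⊆ T m π, D.Countable ∧ T m π ⊆ closure D := fun m π => by
    have : TopologicalSpace.SeparableSpace (ofPerm.{u} m π) :=
      inferInstanceAs (TopologicalSpace.SeparableSpace C(ULift.{u} (Fin m), ℂ))
    exact (TopologicalSpace.IsSeparable.of_separableSpace _).exists_countable_dense_subset
  choose D hDT hDcount hDdense using hdense
  refine ⟨⋃ m, ⋃ π, PointedSystem.mk (ofPerm.{u} m π) '' D m π,
    countable_iUnion fun m => countable_iUnion fun π => (hDcount m π).image _, ?_, ?_⟩
  · simp only [iUnion_subset_iff, image_subset_iff]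
    exact fun m π => hDT m π
  · rintro ⟨A, a⟩ ⟨hA, ha⟩ ε hε
    obtain ⟨m, π, hm, ⟨e⟩⟩ := exists_iso_ofPerm.{u, u} hA
    have hmem : e ∘ a ∈ T m π := ⟨hm, by
      rw [range_comp]
      exact e.generated_image_eq_top ha⟩
    obtain ⟨b, hb, hlt⟩ := EMetric.mem_closure_iff.1 (hDdense m π hmem) ε hε
    exact ⟨⟨_, b⟩, mem_iUnion₂.2 ⟨m, π, b, hb, rfl⟩,
      (jointEDist_map_le hm e.toEmb a b).trans_lt hlt⟩

theorem isFraisseClass_finDimClass : IsFraisseClass FinDimClass.{u} where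
  nonempty := ⟨_, finDimClass_ofHomeo (Homeomorph.refl PUnit.{u + 1})⟩
  finitelyGenerated A hA :=
    have := hA.2
    ⟨_, Module.finBasis ℂ A, A.generated_range_basis _⟩
  hereditary := hereditaryProperty_finDimClass
  jointEmbedding := jointEmbeddingProperty_finDimClass
  amalgamation := amalgamationProperty_finDimClass
  weakPolish := weakPolishProperty_finDimClass

/-! ### Locally finite systems and the extension property -/

/-- The union of all the finite-dimensional invariant star subalgebras. -/
noncomputable def locallyFinitePart (M : CStarSystem.{w}) : StarSubalgebra ℂ M :=
  ⨆ B : {B : StarSubalgebra ℂ M // IsFinInvariant B}, B.1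

theorem mem_locallyFinitePart {x : M} :
    x ∈ M.locallyFinitePart ↔ ∃ B : StarSubalgebra ℂ M, IsFinInvariant B ∧ x ∈ B := by
  have : Nonempty {B : StarSubalgebra ℂ M // IsFinInvariant B} := ⟨⟨⊥, isFinInvariant_bot⟩⟩
  have hdir : Directed (· ≤ ·) fun B : {B : StarSubalgebra ℂ M // IsFinInvariant B} => B.1 :=
    fun B C => ⟨⟨B.1 ⊔ C.1, B.2.sup C.2⟩, le_sup_left, le_sup_right⟩
  rw [locallyFinitePart, ← SetLike.mem_coe, StarSubalgebra.coe_iSup_of_directed hdir, mem_iUnion]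
  simp only [Subtype.exists, exists_prop, SetLike.mem_coe]

/-- A system in which the finite-dimensional invariant star subalgebras have dense union. -/
def IsLocallyFinite (M : CStarSystem.{w}) : Prop :=
  Dense (M.locallyFinitePart : Set M)

theorem IsLocallyFinite.exists_countable_dense [TopologicalSpace.SeparableSpace M]
    (hM : IsLocallyFinite M) :
    ∃ D : Set M, D.Countable ∧ Dense D ∧
      ∀ x ∈ D, ∃ B : StarSubalgebra ℂ M, IsFinInvariant B ∧ x ∈ B := by
  obtain ⟨D, hD, hcount, hdense⟩ := (TopologicalSpace.IsSeparable.of_separableSpace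
    (M.locallyFinitePart : Set M)).exists_countable_dense_subset
  exact ⟨D, hcount, dense_closure.1 (hM.mono hdense), fun x hx => mem_locallyFinitePart.1 (hD hx)⟩

theorem isLocallyFinite_of_isDirectLimitOf (hM : IsDirectLimitOf FinDimClass.{u} M) :
    IsLocallyFinite M := by
  obtain ⟨F, -, -, hF, hdense⟩ := hM
  refine hdense.mono (iUnion₂_subset fun B hB x hx => ?_)
  obtain ⟨A, ⟨-, _⟩, φ, hφ⟩ := hF B hB
  exact mem_locallyFinitePart.2 ⟨φ.toHom.range, φ.isFinInvariant_range, hφ.superset hx⟩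

theorem IsLocallyFinite.isDirectLimitOf [Nontrivial M] (hM : IsLocallyFinite M) :
    IsDirectLimitOf FinDimClass.{u} M := by
  refine ⟨{B | IsFinInvariant B}, ⟨⊥, isFinInvariant_bot⟩, ?_, fun B hB => hB.exists_emb,
    hM.mono fun x hx => ?_⟩
  · exact fun B hB C hC => ⟨B ⊔ C, hB.sup hC, le_sup_left, le_sup_right⟩
  · obtain ⟨B, hB, hxB⟩ := mem_locallyFinitePart.1 hx
    exact mem_biUnion (s := {B | IsFinInvariant B}) hB hxB

/-- The extension property: every embedding of a finite-dimensional system into `M` extends along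
every embedding into a larger finite-dimensional system. -/
def HasExtension (M : CStarSystem.{w}) : Prop :=
  ∀ A B : CStarSystem.{u}, FinDimClass A → FinDimClass B → ∀ (ι : Emb A B) (φ : Emb A M),
    ∃ ψ : Emb B M, ∀ a, ψ (ι a) = φ a

end CStarSystem

theorem IsFraisseLimit.hasExtension {M : CStarSystem.{w}}
    (hM : IsFraisseLimit FinDimClass.{u} M) : HasExtension.{u} M := by
  intro A B hA hB ι φ
  obtain ⟨χ⟩ := hM.universal B hB
  have := hA.2
  obtain ⟨n, b, hb⟩ := exists_basis_isIdempotentElem A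
  obtain ⟨α, hα⟩ := hM.homogeneous A hA (χ.comp ι) φ n b 1 one_pos
  let χ' := α.toEmb.comp χ
  have heq : (χ'.comp ι).toHom.toAlgHom.toLinearMap = φ.toHom.toAlgHom.toLinearMap :=
    b.ext fun i => eq_of_isIdempotentElem_of_norm_sub_lt_one
      ((hb i).map (χ'.comp ι).toHom) ((hb i).map φ.toHom) (hα i)
  exact ⟨χ', DFunLike.congr_fun heq⟩

namespace CStarSystem

/-! ### Back-and-forth -/

variable {A : CStarSystem.{u}} {M : CStarSystem.{v}} {N : CStarSystem.{w}}

/-- The graph of the isomorphism between the images of two embeddings of the same system. -/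
def Emb.jointRange (φ : Emb A M) (ψ : Emb A N) : StarSubalgebra ℂ (M × N) :=
  (φ.toHom.prod ψ.toHom).range

/-- A star subalgebra of `M × N` that is the graph of an isomorphism between finite-dimensional
substructures of `M` and `N`. -/
def IsPartialIso (Γ : StarSubalgebra ℂ (M × N)) : Prop :=
  ∃ A : CStarSystem.{u}, FinDimClass A ∧ ∃ (φ : Emb A M) (ψ : Emb A N), φ.jointRange ψ = Γ

theorem IsPartialIso.norm_eq {Γ : StarSubalgebra ℂ (M × N)} (hΓ : IsPartialIso.{u} Γ) {p : M × N}
    (hp : p ∈ Γ) : ‖p.1‖ = ‖p.2‖ := by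
  obtain ⟨A, -, φ, ψ, rfl⟩ := hΓ
  obtain ⟨a, rfl⟩ := hp
  exact (φ.norm_map a).trans (ψ.norm_map a).symm

theorem IsPartialIso.map_mem {Γ : StarSubalgebra ℂ (M × N)} (hΓ : IsPartialIso.{u} Γ) {p : M × N}
    (hp : p ∈ Γ) : (M.σ p.1, N.σ p.2) ∈ Γ := by
  obtain ⟨A, -, φ, ψ, rfl⟩ := hΓ
  obtain ⟨a, rfl⟩ := hp
  exact ⟨A.σ a, Prod.ext (φ.map_σ a) (ψ.map_σ a)⟩

theorem exists_extension (hN : HasExtension.{u} N) (hA : FinDimClass A) (φ : Emb A M)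
    (ψ : Emb A N) {B : StarSubalgebra ℂ M} (hB : IsFinInvariant B) :
    ∃ A' : CStarSystem.{u}, FinDimClass A' ∧ ∃ (ι : Emb A A') (φ' : Emb A' M) (ψ' : Emb A' N),
      (∀ a, φ' (ι a) = φ a) ∧ (∀ a, ψ' (ι a) = ψ a) ∧ (B : Set M) ⊆ range φ' := by
  obtain ⟨_, _⟩ := hA
  have : Nontrivial M := φ.injective.nontrivial
  obtain ⟨A', hA', φ', hφ'⟩ := (φ.isFinInvariant_range.sup hB).exists_emb
  have hφφ' : range φ ⊆ range φ' := by
    rw [hφ']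
    rintro _ ⟨a, rfl⟩
    exact StarSubalgebra.mem_sup_left ⟨a, rfl⟩
  obtain ⟨ι, hι⟩ := φ.exists_factor φ' hφφ'
  obtain ⟨ψ', hψ'⟩ := hN A A' ⟨‹_›, ‹_›⟩ hA' ι ψ
  exact ⟨A', hA', ι, φ', ψ', hι, hψ', fun x hx => hφ'.superset (StarSubalgebra.mem_sup_right hx)⟩

theorem IsPartialIso.extend_left (hN : HasExtension.{u} N) {Γ : StarSubalgebra ℂ (M × N)}
    (hΓ : IsPartialIso.{u} Γ) {B : StarSubalgebra ℂ M} (hB : IsFinInvariant B) :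
    ∃ Γ' : StarSubalgebra ℂ (M × N), IsPartialIso.{u} Γ' ∧ Γ ≤ Γ' ∧
      ∀ x ∈ B, ∃ y, (x, y) ∈ Γ' := by
  obtain ⟨A, hA, φ, ψ, rfl⟩ := hΓ
  obtain ⟨A', hA', ι, φ', ψ', hφ, hψ, hBφ⟩ := exists_extension hN hA φ ψ hB
  refine ⟨φ'.jointRange ψ', ⟨A', hA', φ', ψ', rfl⟩, ?_, fun x hx => ?_⟩
  · rintro _ ⟨a, rfl⟩
    exact ⟨ι a, Prod.ext (hφ a) (hψ a)⟩
  · obtain ⟨a, rfl⟩ := hBφ hx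
    exact ⟨ψ' a, a, rfl⟩

theorem IsPartialIso.extend_right (hM : HasExtension.{u} M) {Γ : StarSubalgebra ℂ (M × N)}
    (hΓ : IsPartialIso.{u} Γ) {B : StarSubalgebra ℂ N} (hB : IsFinInvariant B) :
    ∃ Γ' : StarSubalgebra ℂ (M × N), IsPartialIso.{u} Γ' ∧ Γ ≤ Γ' ∧
      ∀ y ∈ B, ∃ x, (x, y) ∈ Γ' := by
  obtain ⟨A, hA, φ, ψ, rfl⟩ := hΓ
  obtain ⟨A', hA', ι, ψ', φ', hψ, hφ, hBψ⟩ := exists_extension hM hA ψ φ hB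
  refine ⟨φ'.jointRange ψ', ⟨A', hA', φ', ψ', rfl⟩, ?_, fun y hy => ?_⟩
  · rintro _ ⟨a, rfl⟩
    exact ⟨ι a, Prod.ext (hφ a) (hψ a)⟩
  · obtain ⟨a, rfl⟩ := hBψ hy
    exact ⟨φ' a, a, rfl⟩

theorem exists_directedOn_isPartialIso [TopologicalSpace.SeparableSpace M]
    [TopologicalSpace.SeparableSpace N] (hM : IsLocallyFinite M) (hN : IsLocallyFinite N)
    (hM' : HasExtension.{u} M) (hN' : HasExtension.{u} N) {Γ₀ : StarSubalgebra ℂ (M × N)}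
    (hΓ₀ : IsPartialIso.{u} Γ₀) :
    ∃ F : Set (StarSubalgebra ℂ (M × N)), Γ₀ ∈ F ∧ DirectedOn (· ≤ ·) F ∧
      (∀ Γ ∈ F, IsPartialIso.{u} Γ) ∧ Dense {x : M | ∃ Γ ∈ F, ∃ y, (x, y) ∈ Γ} ∧
      Dense {y : N | ∃ Γ ∈ F, ∃ x, (x, y) ∈ Γ} := by
  obtain ⟨D, hDcount, hDdense, hD⟩ := hM.exists_countable_dense
  obtain ⟨E, hEcount, hEdense, hE⟩ := hN.exists_countable_dense
  have := hDcount.to_subtype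
  have := hEcount.to_subtype
  let _ : Encodable (D ⊕ E) := Encodable.ofCountable _
  let P := {Γ : StarSubalgebra ℂ (M × N) // IsPartialIso.{u} Γ}
  let meets : D ⊕ E → Order.Cofinal P := Sum.elim
    (fun x => ⟨{Γ | ∃ y, ((x : M), y) ∈ Γ.1}, fun Γ => by
      obtain ⟨B, hB, hx⟩ := hD x x.2
      obtain ⟨Γ', hΓ', hle, h⟩ := Γ.2.extend_left hN' hB
      exact ⟨⟨Γ', hΓ'⟩, h x hx, hle⟩⟩)
    (fun y => ⟨{Γ | ∃ x, (x, (y : N)) ∈ Γ.1}, fun Γ => by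
      obtain ⟨B, hB, hy⟩ := hE y y.2
      obtain ⟨Γ', hΓ', hle, h⟩ := Γ.2.extend_right hM' hB
      exact ⟨⟨Γ', hΓ'⟩, h y hy, hle⟩⟩)
  let I := Order.idealOfCofinals (⟨Γ₀, hΓ₀⟩ : P) meets
  refine ⟨Subtype.val '' (I : Set P), ⟨_, Order.mem_idealOfCofinals _ _, rfl⟩,
    directedOn_image.2 I.directed, ?_, hDdense.mono fun x hx => ?_, hEdense.mono fun y hy => ?_⟩
  · rintro _ ⟨Γ, -, rfl⟩
    exact Γ.2
  · obtain ⟨Γ, hxΓ, hΓ⟩ := Order.cofinal_meets_idealOfCofinals (⟨Γ₀, hΓ₀⟩ : P) meets (.inl ⟨x, hx⟩)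
    exact ⟨Γ, ⟨Γ, hΓ, rfl⟩, hxΓ⟩
  · obtain ⟨Γ, hyΓ, hΓ⟩ := Order.cofinal_meets_idealOfCofinals (⟨Γ₀, hΓ₀⟩ : P) meets (.inr ⟨y, hy⟩)
    exact ⟨Γ, ⟨Γ, hΓ, rfl⟩, hyΓ⟩

theorem exists_iso_of_graph (Γ : StarSubalgebra ℂ (M × N)) (hnorm : ∀ p ∈ Γ, ‖p.1‖ = ‖p.2‖)
    (hσ : ∀ p ∈ Γ, (M.σ p.1, N.σ p.2) ∈ Γ) (hM : Dense (Prod.fst '' (Γ : Set (M × N))))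
    (hN : Dense (Prod.snd '' (Γ : Set (M × N)))) :
    ∃ e : Iso M N, ∀ p ∈ Γ, e p.1 = p.2 := by
  have hle : (Γ : Set (M × N)) ⊆ Γ.topologicalClosure := Γ.le_topologicalClosure
  have : IsClosed (Γ.topologicalClosure : Set (M × N)) := Γ.isClosed_topologicalClosure
  have hnorm' : ∀ p ∈ Γ.topologicalClosure, ‖p.1‖ = ‖p.2‖ := fun p hp =>
    closure_minimal (s := (Γ : Set (M × N))) hnorm
      (isClosed_eq continuous_fst.norm continuous_snd.norm) hp
  obtain ⟨e, he⟩ := exists_starAlgEquiv_of_isClosed_graph Γ.topologicalClosure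
    (fun p hp => by rw [← norm_eq_zero, hnorm' p hp, norm_eq_zero])
    (hM.mono (image_mono hle)) (hN.mono (image_mono hle))
  have heσ : (fun x => e (M.σ x)) = fun x => N.σ (e x) := by
    have hcont : Continuous e := (NonUnitalStarAlgHom.isometry e e.injective).continuous
    refine (hcont.comp M.continuous_σ).ext_on hM (N.continuous_σ.comp hcont) ?_
    rintro _ ⟨p, hp, rfl⟩
    exact (he _ (hle (hσ p hp))).trans (congrArg N.σ (he p (hle hp)).symm)
  exact ⟨⟨e, congrFun heσ⟩, fun p hp => he p (hle hp)⟩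

theorem exists_iso_of_directedOn {F : Set (StarSubalgebra ℂ (M × N))} (hne : F.Nonempty)
    (hdir : DirectedOn (· ≤ ·) F) (hF : ∀ Γ ∈ F, IsPartialIso.{u} Γ)
    (hM : Dense {x : M | ∃ Γ ∈ F, ∃ y, (x, y) ∈ Γ})
    (hN : Dense {y : N | ∃ Γ ∈ F, ∃ x, (x, y) ∈ Γ}) :
    ∃ e : Iso M N, ∀ Γ ∈ F, ∀ p ∈ Γ, e p.1 = p.2 := by
  have := hne.to_subtype
  let T : StarSubalgebra ℂ (M × N) := ⨆ Γ : F, Γ.1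
  have hT : ∀ p, p ∈ T ↔ ∃ Γ ∈ F, p ∈ Γ := fun p => by
    rw [← SetLike.mem_coe, StarSubalgebra.coe_iSup_of_directed hdir.directed_val, mem_iUnion]
    simp only [Subtype.exists, exists_prop, SetLike.mem_coe]
  have hfst : {x : M | ∃ Γ ∈ F, ∃ y, (x, y) ∈ Γ} ⊆ Prod.fst '' (T : Set (M × N)) :=
    fun x ⟨Γ, hΓ, y, h⟩ => ⟨(x, y), (hT _).2 ⟨Γ, hΓ, h⟩, rfl⟩
  have hsnd : {y : N | ∃ Γ ∈ F, ∃ x, (x, y) ∈ Γ} ⊆ Prod.snd '' (T : Set (M × N)) :=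
    fun y ⟨Γ, hΓ, x, h⟩ => ⟨(x, y), (hT _).2 ⟨Γ, hΓ, h⟩, rfl⟩
  obtain ⟨e, he⟩ := exists_iso_of_graph T
    (fun p hp =>
      let ⟨Γ, hΓ, hpΓ⟩ := (hT p).1 hp
      (hF Γ hΓ).norm_eq hpΓ)
    (fun p hp =>
      let ⟨Γ, hΓ, hpΓ⟩ := (hT p).1 hp
      (hT _).2 ⟨Γ, hΓ, (hF Γ hΓ).map_mem hpΓ⟩)
    (hM.mono hfst) (hN.mono hsnd)
  exact ⟨e, fun Γ hΓ p hp => he p ((hT p).2 ⟨Γ, hΓ, hp⟩)⟩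

theorem exists_iso_extending [TopologicalSpace.SeparableSpace M] [TopologicalSpace.SeparableSpace N]
    (hM : IsLocallyFinite M) (hN : IsLocallyFinite N) (hM' : HasExtension.{u} M)
    (hN' : HasExtension.{u} N) (hA : FinDimClass A) (φ : Emb A M) (ψ : Emb A N) :
    ∃ e : Iso M N, ∀ a, e (φ a) = ψ a := by
  obtain ⟨F, hmem, hdir, hF, hfst, hsnd⟩ := exists_directedOn_isPartialIso hM hN hM' hN'
    (Γ₀ := φ.jointRange ψ) ⟨A, hA, φ, ψ, rfl⟩
  obtain ⟨e, he⟩ := exists_iso_of_directedOn ⟨_, hmem⟩ hdir hF hfst hsnd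
  exact ⟨e, fun a => he _ hmem (φ a, ψ a) ⟨a, rfl⟩⟩

theorem isFraisseLimit_of_hasExtension [TopologicalSpace.SeparableSpace M] [Nontrivial M]
    (hM : IsLocallyFinite M) (hM' : HasExtension.{u} M)
    (huniv : ∀ A : CStarSystem.{u}, FinDimClass A → Nonempty (Emb A M)) :
    IsFraisseLimit FinDimClass.{u} M where
  separable := inferInstance
  directLimit := hM.isDirectLimitOf
  universal := huniv
  homogeneous A hA φ ψ n a ε hε := by
    obtain ⟨e, he⟩ := exists_iso_extending hM hM hM' hM' hA φ ψ
    exact ⟨e, fun i => by rwa [he, sub_self, norm_zero]⟩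

end CStarSystem

theorem IsFraisseLimit.nonempty_iso {M : CStarSystem.{v}} {N : CStarSystem.{w}}
    (hM : IsFraisseLimit FinDimClass.{u} M) (hN : IsFraisseLimit FinDimClass.{u} N) :
    Nonempty (Iso M N) := by
  have := hM.separable
  have := hN.separable
  obtain ⟨A, hA⟩ := isFraisseClass_finDimClass.{u}.nonempty
  obtain ⟨φ⟩ := hM.universal A hA
  obtain ⟨ψ⟩ := hN.universal A hA
  obtain ⟨e, -⟩ := exists_iso_extending (isLocallyFinite_of_isDirectLimitOf hM.directLimit)
    (isLocallyFinite_of_isDirectLimitOf hN.directLimit) hM.hasExtension hN.hasExtension hA φ ψ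
  exact ⟨e⟩

/-! ### Lifting along finite permutations -/

/-- `τ` is a locally constant factor of `S`, via the equivariant surjection `f`. -/
structure IsFactorMap {X F : Type*} [TopologicalSpace X] (S : X → X) (τ : F → F) (f : X → F) :
    Prop where
  isLocallyConstant : IsLocallyConstant f
  surjective : Surjective f
  semiconj : Semiconj f S τ

theorem IsFactorMap.comp_homeo {X Y F : Type*} [TopologicalSpace X] [TopologicalSpace Y]
    {S : X → X} {T : Y → Y} {τ : F → F} {f : Y → F} (hf : IsFactorMap T τ f) (e : X ≃ₜ Y)
    (he : Semiconj e S T) : IsFactorMap S τ (f ∘ e) where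
  isLocallyConstant := hf.isLocallyConstant.comp_continuous e.continuous
  surjective := hf.surjective.comp e.surjective
  semiconj := hf.semiconj.comp_left he

/-- Factor maps of `S` onto a finite permutation lift along every equivariant surjection of finite
permutations. -/
def HasFiniteLifts {X : Type*} [TopologicalSpace X] (S : X → X) : Prop :=
  ∀ (A B : Type u) [Finite B] (τA : Equiv.Perm A) (τB : Equiv.Perm B) (p : B → A),
    Surjective p → Semiconj p τB τA → ∀ f : X → A, IsFactorMap S τA f →
      ∃ q : X → B, IsFactorMap S τB q ∧ ∀ x, p (q x) = f x

/-- The locally constant equivariant maps from `S` to self-maps of finite sets separate points. -/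
def SeparatedByFiniteFactors {X : Type*} [TopologicalSpace X] (S : X → X) : Prop :=
  ∀ x y, x ≠ y → ∃ (F : Type) (_ : Finite F) (τ : F → F) (π : X → F),
    IsLocallyConstant π ∧ Semiconj π S τ ∧ π x ≠ π y

section Conj

variable {X Y : Type*} [TopologicalSpace X] [TopologicalSpace Y] {S : X → X} {T : Y → Y}

theorem HasFiniteLifts.conj (hS : HasFiniteLifts.{u} S) (e : X ≃ₜ Y) (he : Semiconj e S T) :
    HasFiniteLifts.{u} T := by
  intro A B _ τA τB p hp hpτ f hf
  obtain ⟨q, hq, hpq⟩ := hS A B τA τB p hp hpτ _ (hf.comp_homeo e he)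
  have he' : Semiconj e.symm T S := he.inverse_left e.left_inv e.right_inv
  exact ⟨q ∘ e.symm, hq.comp_homeo e.symm he', fun y =>
    (hpq _).trans (congrArg f (e.apply_symm_apply y))⟩

theorem SeparatedByFiniteFactors.conj (hS : SeparatedByFiniteFactors S) (e : X ≃ₜ Y)
    (he : Semiconj e S T) : SeparatedByFiniteFactors T := by
  intro x y hxy
  obtain ⟨F, hF, τ, π, hπ, hπτ, hne⟩ := hS _ _ (e.symm.injective.ne hxy)
  have he' : Semiconj e.symm T S := he.inverse_left e.left_inv e.right_inv
  exact ⟨F, hF, τ, π ∘ e.symm, hπ.comp_continuous e.symm.continuous, hπτ.comp_left he', hne⟩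

end Conj

namespace CStarSystem

variable {X : Type v} [TopologicalSpace X] [CompactSpace X] {S : X ≃ₜ X}

theorem comp_mem_locallyFinitePart {F : Type*} [Finite F] [TopologicalSpace F] [DiscreteTopology F]
    {π : C(X, F)} {τ : F → F} (hπ : Semiconj π S τ) (g : C(F, ℂ)) :
    g.comp π ∈ (ofHomeo S).locallyFinitePart := by
  let pullback : C(F, ℂ) →⋆ₐ[ℂ] ofHomeo S := ContinuousMap.compStarAlgHom' ℂ ℂ π
  refine mem_locallyFinitePart.2 ⟨pullback.range, isFinInvariant_range pullback fun a => ?_, g, rfl⟩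
  exact ⟨a.comp ⟨τ, continuous_of_discreteTopology⟩,
    ContinuousMap.ext (X := X) (Y := ℂ) fun x => congrArg a (hπ x).symm⟩

theorem isLocallyFinite_ofHomeo (hS : SeparatedByFiniteFactors S) :
    IsLocallyFinite (ofHomeo S) := by
  classical
  let T : StarSubalgebra ℂ C(X, ℂ) := (ofHomeo S).locallyFinitePart
  have hsep : T.SeparatesPoints := by
    intro x y hxy
    obtain ⟨F, _, τ, π, hπ, hπτ, hne⟩ := hS x y hxy
    let _ : TopologicalSpace F := ⊥
    have : DiscreteTopology F := ⟨rfl⟩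
    let π' : C(X, F) := ⟨π, hπ.continuous⟩
    let indicator : C(F, ℂ) := ⟨Pi.single (π x) 1, continuous_of_discreteTopology⟩
    refine ⟨indicator.comp π', ⟨_, comp_mem_locallyFinitePart (π := π') hπτ _, rfl⟩, ?_⟩
    change (Pi.single (π x) 1 : F → ℂ) (π x) ≠ (Pi.single (π x) 1 : F → ℂ) (π y)
    rw [Pi.single_eq_same, Pi.single_eq_of_ne hne.symm]
    exact one_ne_zero
  have htop := ContinuousMap.starSubalgebra_topologicalClosure_eq_top_of_separatesPoints T hsep
  exact dense_iff_closure_eq.2 (congrArg SetLike.coe htop)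

theorem exists_emb_of_isFactorMap {B : CStarSystem.{u}} {q : X → characterSpace ℂ B}
    (hq : IsFactorMap S B.specHomeo q) :
    ∃ ψ : Emb B (ofHomeo S), ∀ b x, DFunLike.coe (F := C(X, ℂ)) (ψ b) x = q x b :=
  ⟨Emb.ofSurjective ⟨q, hq.isLocallyConstant.continuous⟩ hq.surjective hq.semiconj, fun _ _ => rfl⟩

theorem hasExtension_ofHomeo [T2Space X] (hS : HasFiniteLifts.{u} S) :
    HasExtension.{u} (ofHomeo S) := by
  intro A B ⟨_, _⟩ ⟨_, _⟩ ι φ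
  have hφ : IsFactorMap S A.specHomeo φ.evalDual :=
    ⟨(IsLocallyConstant.iff_continuous _).2 φ.evalDual.continuous, φ.evalDual_surjective,
      φ.evalDual_semiconj⟩
  obtain ⟨q, hq, hιq⟩ := hS _ _ A.specHomeo.toEquiv B.specHomeo.toEquiv ι.dual ι.dual_surjective
    ι.dual_semiconj _ hφ
  obtain ⟨ψ, hψ⟩ := exists_emb_of_isFactorMap hq
  exact ⟨ψ, fun a => ContinuousMap.ext (X := X) (Y := ℂ) fun x =>
    (hψ _ x).trans (DFunLike.congr_fun (hιq x) a)⟩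

theorem nonempty_emb_ofHomeo [Nonempty X] (hS : HasFiniteLifts.{u} S) {A : CStarSystem.{u}}
    (hA : FinDimClass A) : Nonempty (Emb A (ofHomeo S)) := by
  obtain ⟨_, _⟩ := hA
  obtain ⟨q, hq, -⟩ := hS PUnit _ 1 A.specHomeo.toEquiv (fun _ => PUnit.unit)
    (fun _ => ⟨Classical.arbitrary _, rfl⟩) (fun _ => rfl) (fun _ => PUnit.unit)
    ⟨IsLocallyConstant.const _, fun _ => ⟨Classical.arbitrary _, rfl⟩, fun _ => rfl⟩
  exact (exists_emb_of_isFactorMap hq).nonempty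

theorem isFraisseLimit_ofHomeo [T2Space X] [Nonempty X] [TopologicalSpace.SeparableSpace C(X, ℂ)]
    (hS : HasFiniteLifts.{u} S) (hS' : SeparatedByFiniteFactors S) :
    IsFraisseLimit FinDimClass.{u} (ofHomeo S) := by
  have : TopologicalSpace.SeparableSpace (ofHomeo S) :=
    inferInstanceAs (TopologicalSpace.SeparableSpace C(X, ℂ))
  have : Nontrivial (ofHomeo S) := inferInstanceAs (Nontrivial C(X, ℂ))
  exact isFraisseLimit_of_hasExtension (isLocallyFinite_ofHomeo hS') (hasExtension_ofHomeo hS)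
    fun _ => nonempty_emb_ofHomeo hS

end CStarSystem

/-! ### Cycles and the Cantor set -/

theorem exists_finset_dependsOn_of_isLocallyConstant {ι : Type*} {Y : ι → Type*}
    [∀ i, TopologicalSpace (Y i)] [CompactSpace (∀ i, Y i)] {A : Type*} {f : (∀ i, Y i) → A}
    (hf : IsLocallyConstant f) : ∃ s : Finset ι, DependsOn f (s : Set ι) := by
  classical
  have hbox : ∀ x, ∃ (I : Finset ι) (U : ∀ i, Set (Y i)), (∀ i ∈ I, IsOpen (U i) ∧ x i ∈ U i) ∧
      (I : Set ι).pi U ⊆ f ⁻¹' {f x} := fun x => isOpen_pi_iff.1 (hf {f x}) x rfl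
  choose I U hU hsub using hbox
  obtain ⟨t, ht⟩ := CompactSpace.elim_nhds_subcover (fun x => (I x : Set ι).pi (U x)) fun x =>
    (isOpen_set_pi (I x).finite_toSet fun i hi => (hU x i hi).1).mem_nhds fun i hi => (hU x i hi).2
  refine ⟨t.biUnion I, fun x y hxy => ?_⟩
  obtain ⟨z, hz, hxz⟩ := mem_iUnion₂.1 (ht.superset (mem_univ x))
  have hyz : y ∈ (I z : Set ι).pi (U z) := fun i hi => by
    rw [← hxy i (Finset.mem_biUnion.2 ⟨z, hz, hi⟩)]
    exact hxz i hi
  exact (hsub z hxz).trans (hsub z hyz).symm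

theorem exists_isLocallyConstant_range_eq {T : Type*} {t : Set T} (ht : t.Finite)
    (hne : t.Nonempty) : ∃ f : (ℕ → Bool) → T, IsLocallyConstant f ∧ range f = t := by
  have := ht.to_subtype
  have := hne.to_subtype
  let _ : TopologicalSpace t := ⊥
  have : DiscreteTopology t := ⟨rfl⟩
  let _ : MetricSpace t := TopologicalSpace.metrizableSpaceMetric t
  obtain ⟨f, hf, hsurj⟩ := exists_nat_bool_continuous_surjective_of_compact t
  refine ⟨Subtype.val ∘ f, ((IsLocallyConstant.iff_continuous f).2 hf).comp _, ?_⟩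
  rw [hsurj.range_comp, Subtype.range_coe]

/-- A Cantor set is the disjoint union of two Cantor sets, according to the first bit. -/
def cantorSumHomeo : ((ℕ → Bool) ⊕ (ℕ → Bool)) ≃ₜ (ℕ → Bool) where
  toFun := Sum.elim (fun c n => Nat.casesOn n false c) (fun c n => Nat.casesOn n true c)
  invFun c := if c 0 = true then Sum.inr fun n => c (n + 1) else Sum.inl fun n => c (n + 1)
  left_inv := by rintro (c | c) <;> simp
  right_inv c := by
    rcases h : c 0
    all_goals
      ext n
      cases n <;> simp [h]
  continuous_toFun := by
    refine continuous_sum_dom.2 ⟨continuous_pi fun n => ?_, continuous_pi fun n => ?_⟩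
    all_goals
      cases n
      · exact continuous_const
      · exact continuous_apply _
  continuous_invFun := by
    refine Continuous.if (fun c hc => ?_) (by fun_prop) (by fun_prop)
    have hclopen : IsClopen {c : ℕ → Bool | c 0 = true} :=
      (isClopen_discrete {true}).preimage (continuous_apply 0)
    rw [hclopen.frontier_eq] at hc
    exact hc.elim

theorem nonempty_finProd_homeo_cantor (n : ℕ) :
    Nonempty (Fin (n + 1) × (ℕ → Bool) ≃ₜ (ℕ → Bool)) := by
  induction n with
  | zero => exact ⟨Homeomorph.uniqueProd (X := Fin 1) (Y := ℕ → Bool)⟩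
  | succ n ih =>
    obtain ⟨e⟩ := ih
    have f : Fin (n + 2) ≃ₜ Fin (n + 1) ⊕ Fin 1 :=
      (finSumFinEquiv (m := n + 1) (n := 1)).symm.toHomeomorphOfDiscrete
    exact ⟨(f.prodCongr (Homeomorph.refl _)).trans <| Homeomorph.sumProdDistrib.trans <|
      (e.sumCongr (Homeomorph.uniqueProd (X := Fin 1) (Y := ℕ → Bool))).trans cantorSumHomeo⟩

theorem pow_fin_val_add_one {G : Type*} [Monoid G] {g : G} {n : ℕ} (hg : g ^ (n + 1) = 1)
    (j : Fin (n + 1)) : g ^ ((j + 1 : Fin (n + 1)) : ℕ) = g * g ^ (j : ℕ) := by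
  rw [Fin.val_add, Fin.val_one', Nat.add_mod_mod, ← pow_succ', ← pow_eq_pow_mod _ hg]

theorem exists_equivariant_fiber_choice {A B : Type*} [Finite B] {τA : Equiv.Perm A}
    {τB : Equiv.Perm B} {p : B → A} (hp : Surjective p) (hpτ : Semiconj p τB τA) {n : ℕ}
    (hn : τB ^ (n + 1) = 1) :
    ∃ r : A → Fin (n + 1) × (ℕ → Bool) → B, (∀ a, IsLocallyConstant (r a)) ∧
      (∀ b, ∃ z, r (p b) z = b) ∧ (∀ a z, p (r a z) = a) ∧
      ∀ a j c, r (τA a) (j + 1, c) = τB (r a (j, c)) := by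
  have hpow : ∀ (k : ℕ) b, p ((τB ^ k) b) = (τA ^ k) (p b) := fun k b => by
    rw [← Equiv.Perm.iterate_eq_pow, ← Equiv.Perm.iterate_eq_pow]
    exact hpτ.iterate_right k b
  have hn' : τA ^ (n + 1) = 1 := Equiv.ext <| hp.forall.2 fun b => by
    rw [← hpow, hn, Equiv.Perm.one_apply, Equiv.Perm.one_apply]
  have hfiber : ∀ a, ∃ s : (ℕ → Bool) → B, IsLocallyConstant s ∧ range s = p ⁻¹' {a} :=
    fun a => exists_isLocallyConstant_range_eq (toFinite _) (hp a)
  choose s hs hrange using hfiber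
  have hps : ∀ a c, p (s a c) = a := fun a c => (hrange a).subset ⟨c, rfl⟩
  -- Over the base point of the cycle, the Cantor coordinate chooses a point of the fibre; over `j`,
  -- the point chosen `j` steps earlier is carried along by `τB ^ j`.
  refine ⟨fun a z => (τB ^ (z.1 : ℕ)) (s ((τA ^ (z.1 : ℕ)).symm a) z.2), fun a => ?_, fun b => ?_,
    fun a z => ?_, fun a j c => ?_⟩
  · refine (IsLocallyConstant.iff_eventually_eq _).2 fun z => ?_
    filter_upwards [((isOpen_discrete {z.1}).preimage continuous_fst).mem_nhds rfl,
      ((hs ((τA ^ (z.1 : ℕ)).symm a)).comp_continuous continuous_snd).eventually_eq z]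
      with w (hfst : w.1 = z.1) hsnd
    rw [hfst]
    exact congrArg _ hsnd
  · obtain ⟨c, hc⟩ := (hrange (p b)).superset (mem_singleton (p b))
    exact ⟨(0, c), hc⟩
  · rw [hpow, hps, Equiv.apply_symm_apply]
  · have hback : (τA ^ ((j + 1 : Fin (n + 1)) : ℕ)).symm (τA a) = (τA ^ (j : ℕ)).symm a := by
      rw [Equiv.symm_apply_eq, pow_fin_val_add_one hn', Equiv.Perm.mul_apply,
        Equiv.apply_symm_apply]
    dsimp only
    rw [hback, pow_fin_val_add_one hn, Equiv.Perm.mul_apply]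

/-- The product over `n` of a cycle of length `n + 1` and a Cantor set. -/
abbrev CyclicCantor : Type := ∀ n : ℕ, Fin (n + 1) × (ℕ → Bool)

namespace CyclicCantor

/-- The simultaneous rotation of all the cycles. -/
noncomputable def shift : CyclicCantor ≃ₜ CyclicCantor :=
  Homeomorph.piCongrRight fun n =>
    (Equiv.addRight (1 : Fin (n + 1))).toHomeomorphOfDiscrete.prodCongr (Homeomorph.refl _)

theorem nonempty_homeo_cantor : Nonempty (CyclicCantor ≃ₜ (ℕ → Bool)) :=
  ⟨(Homeomorph.piCongrRight fun n => (nonempty_finProd_homeo_cantor n).some).trans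
    cantorSpaceHomeomorphNatToCantorSpace.symm⟩

theorem hasFiniteLifts_shift : HasFiniteLifts.{u} shift := by
  intro A B _ τA τB p hp hpτ f hf
  obtain ⟨s, hs⟩ := exists_finset_dependsOn_of_isLocallyConstant hf.isLocallyConstant
  obtain ⟨n, hns, hn⟩ : ∃ n ∉ s, τB ^ (n + 1) = 1 := by
    obtain ⟨m, hm⟩ := s.exists_nat_subset_range
    have hpos := Nat.mul_pos (orderOf_pos τB) m.succ_pos
    refine ⟨orderOf τB * (m + 1) - 1, fun h => ?_, ?_⟩
    · have := Finset.mem_range.1 (hm h)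
      nlinarith [orderOf_pos τB, Nat.sub_add_cancel hpos]
    · rw [Nat.sub_add_cancel hpos, pow_mul, pow_orderOf_eq_one, one_pow]
  obtain ⟨r, hr, hrsurj, hpr, hrτ⟩ := exists_equivariant_fiber_choice hp hpτ hn
  refine ⟨fun x => r (f x) (x n), ⟨?_, fun b => ?_, fun x => ?_⟩, fun x => hpr _ _⟩
  · refine (IsLocallyConstant.iff_eventually_eq _).2 fun x => ?_
    filter_upwards [hf.isLocallyConstant.eventually_eq x,
      ((hr (f x)).comp_continuous (continuous_apply n)).eventually_eq x] with y hfy hry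
    exact (congrArg (r · (y n)) hfy).trans hry
  · obtain ⟨x, hx⟩ := hf.surjective (p b)
    obtain ⟨z, hz⟩ := hrsurj b
    have hfx : f (update x n z) = p b :=
      (hs fun i hi => update_of_ne (ne_of_mem_of_not_mem hi hns) z x).trans hx
    exact ⟨update x n z, by simp only [hfx, update_self, hz]⟩
  · exact (congrArg (r · _) (hf.semiconj x)).trans (hrτ _ _ _)

theorem separatedByFiniteFactors_shift : SeparatedByFiniteFactors shift := by
  intro x y hxy
  obtain ⟨n, hn⟩ := ne_iff.1 hxy
  obtain ⟨i, hi⟩ : ∃ i, ((x n).1, (x n).2 i) ≠ ((y n).1, (y n).2 i) := by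
    by_contra! h
    exact hn (Prod.ext (Prod.ext_iff.1 (h 0)).1 (funext fun i => (Prod.ext_iff.1 (h i)).2))
  refine ⟨Fin (n + 1) × Bool, inferInstance, Prod.map (· + 1) id, fun z => ((z n).1, (z n).2 i),
    (IsLocallyConstant.iff_continuous _).2 ?_, fun z => rfl, hi⟩
  fun_prop

end CyclicCantor

theorem theorem4p1 :
    IsFraisseClass FinDimClass.{u} ∧
    ∃ S : (ℕ → Bool) ≃ₜ (ℕ → Bool),
      IsFraisseLimit FinDimClass.{u} (CStarSystem.ofHomeo S) ∧
      ∀ M : CStarSystem.{v}, IsFraisseLimit FinDimClass.{u} M →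
        Nonempty (CStarSystem.Iso M (CStarSystem.ofHomeo S)) := by
  obtain ⟨e⟩ := CyclicCantor.nonempty_homeo_cantor
  let S := e.symm.trans (CyclicCantor.shift.trans e)
  have he : Semiconj e CyclicCantor.shift S := fun x =>
    congrArg (fun y => e (CyclicCantor.shift y)) (e.symm_apply_apply x).symm
  have hS : IsFraisseLimit FinDimClass.{u} (CStarSystem.ofHomeo S) :=
    isFraisseLimit_ofHomeo (CyclicCantor.hasFiniteLifts_shift.conj e he)
      (CyclicCantor.separatedByFiniteFactors_shift.conj e he)
  exact ⟨isFraisseClass_finDimClass, S, hS, fun _ hM => hM.nonempty_iso hS⟩
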